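/- For $n\ge 1$ let $C_n$ be the symmetry group of the $n$-cube, i.e. the finite group of all linear isometries of $\mathbb{R}^n$ that map the set $\{\pm e_1,\dots,\pm e_n\}$ onto itself, where $e_1,\dots,e_n$ is the standard orthonormal basis. Let $r_1\in C_n$ be the reflection with root $e_1$ (it inverts the first coordinate) and, for $n\ge 2$, let $r_{+1,1,2}\in C_n$ be the reflection with root $e_1-e_2$ (it permutes the first two coordinates). Let $\mathrm{End}(C_n)$ be the finite set of all group homomorphisms $C_n\to C_n$, and for $r\in C_n$ write $$\mathbb{P}_{\varphi\in\mathrm{End}(C_n)}\big[r\in\ker\varphi\big]=\frac{|\{\varphi\in\mathrm{End}(C_n): r\in\ker\varphi\}|}{|\mathrm{End}(C_n)|}$$ for the probability that $r$ lies in the kernel of a uniformly random endomorphism of $C_n$. (1) For every choice, for each $n$, of an element $r^{(n)}\in C_n$ that is conjugate in $C_n$ to $r_{+1,1,2}$ whenever $n\ge 2$, one has $\lim_{n\to\infty}\mathbb{P}_{\varphi\in\mathrm{End}(C_n)}[r^{(n)}\in\ker\varphi]=0$. (2) For every choice, for each $n\ge 1$, of an element $r^{(n)}\in C_n$ that is conjugate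 in $C_n$ to $r_1$, one has $\lim_{n\to\infty}\mathbb{P}_{\varphi\in\mathrm{End}(C_n)}[r^{(n)}\in\ker\varphi]=\tfrac14$. -/

import Mathlib

open Filter Topology

noncomputable section

/-- The set `{± e_1, …, ± e_n}` of signed standard basis vectors of Euclidean space `ℝⁿ`. -/
def signedBasis (n : ℕ) : Set (EuclideanSpace ℝ (Fin n)) :=
  {x | ∃ i, x = EuclideanSpace.single i (1 : ℝ) ∨ x = -EuclideanSpace.single i (1 : ℝ)}

/-- The group `C_n`, the symmetry group of the `n`-cube: the linear isometries of `ℝⁿ` that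
permute and invert the vectors of the standard orthonormal basis, that is, that map the set
`{± e_1, …, ± e_n}` onto itself. -/
def hyperoctahedral (n : ℕ) :
    Subgroup (EuclideanSpace ℝ (Fin n) ≃ₗᵢ[ℝ] EuclideanSpace ℝ (Fin n)) where
  carrier := {w | w '' signedBasis n = signedBasis n}
  one_mem' := by
    change (fun x => x) '' _ = _
    simp
  mul_mem' := by
    intro a b ha hb
    change (fun x => a (b x)) '' _ = _
    rw [← Set.image_image (fun x => a x) (fun x => b x)]
    exact (congrArg (fun s => a '' s) hb).trans ha
  inv_mem' := by
    intro a ha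
    change (fun x => a.symm x) '' _ = _
    conv_lhs => rw [← show a '' signedBasis n = signedBasis n from ha]
    rw [Set.image_image]
    simp

theorem finite_signedBasis (n : ℕ) : (signedBasis n).Finite := by
  have h : signedBasis n ⊆ Set.range (fun i : Fin n => EuclideanSpace.single i (1 : ℝ)) ∪
      Set.range (fun i : Fin n => -EuclideanSpace.single i (1 : ℝ)) := by
    rintro x ⟨i, rfl | rfl⟩
    · exact Or.inl ⟨i, rfl⟩
    · exact Or.inr ⟨i, rfl⟩
  exact ((Set.finite_range _).union (Set.finite_range _)).subset h

theorem mem_hyperoctahedral_of_single {n : ℕ}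
    {w : EuclideanSpace ℝ (Fin n) ≃ₗᵢ[ℝ] EuclideanSpace ℝ (Fin n)}
    (h : ∀ i, w (EuclideanSpace.single i (1 : ℝ)) ∈ signedBasis n) : w ∈ hyperoctahedral n := by
  have hsub : w '' signedBasis n ⊆ signedBasis n := by
    rintro _ ⟨x, ⟨i, rfl | rfl⟩, rfl⟩
    · exact h i
    · obtain ⟨j, hj | hj⟩ := h i
      · exact ⟨j, Or.inr (by rw [map_neg, hj])⟩
      · exact ⟨j, Or.inl (by rw [map_neg, hj, neg_neg])⟩
  change w '' signedBasis n = signedBasis n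
  exact Set.eq_of_subset_of_ncard_le hsub
    (Set.ncard_image_of_injective _ w.injective).ge (finite_signedBasis n)

instance finite_hyperoctahedral (n : ℕ) : Finite (hyperoctahedral n) := by
  have := (finite_signedBasis n).to_subtype
  let f : hyperoctahedral n → Fin n → signedBasis n := fun w i =>
    ⟨w.1 (EuclideanSpace.single i (1 : ℝ)), by
      have hw : w.1 '' signedBasis n = signedBasis n := w.2
      rw [← hw]
      exact Set.mem_image_of_mem _ ⟨i, Or.inl rfl⟩⟩
  refine Finite.of_injective f fun a b hab => ?_
  apply Subtype.ext
  apply LinearIsometryEquiv.toLinearEquiv_injective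
  refine (EuclideanSpace.basisFun (Fin n) ℝ).toBasis.ext' fun i => ?_
  have := congrArg Subtype.val (congrFun hab i)
  simpa [f] using this

/-- The orthogonal reflection of `ℝⁿ` with root `v`, in the hyperplane orthogonal to `v`. -/
def rootReflection {n : ℕ} (v : EuclideanSpace ℝ (Fin n)) :
    EuclideanSpace ℝ (Fin n) ≃ₗᵢ[ℝ] EuclideanSpace ℝ (Fin n) :=
  (Submodule.span ℝ {v})ᗮ.reflection

/-- The reflection `r_i` of `C_n`, with root `e_i`, which inverts the `i`th coordinate. -/
def invertReflection {n : ℕ} (i : Fin n) : hyperoctahedral n :=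
  ⟨rootReflection (EuclideanSpace.single i (1 : ℝ)), by
    refine mem_hyperoctahedral_of_single fun k => ?_
    by_cases hk : k = i
    · subst hk
      exact ⟨k, Or.inr (Submodule.reflection_orthogonalComplement_singleton_eq_neg _)⟩
    · refine ⟨k, Or.inl (Submodule.reflection_mem_subspace_eq_self ?_)⟩
      rw [Submodule.mem_orthogonal_singleton_iff_inner_right]
      simp [EuclideanSpace.inner_single_left, Ne.symm hk]⟩

theorem rootReflection_sub_single {n : ℕ} (i j : Fin n) :
    rootReflection (EuclideanSpace.single i (1 : ℝ) - EuclideanSpace.single j (1 : ℝ))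
      (EuclideanSpace.single i (1 : ℝ)) = EuclideanSpace.single j (1 : ℝ) :=
  Submodule.reflection_sub (by simp)

theorem rootReflection_rootReflection {n : ℕ} (v x : EuclideanSpace ℝ (Fin n)) :
    rootReflection v (rootReflection v x) = x :=
  Submodule.reflection_reflection _ _

/-- The reflection `r_{+1,i,j}` of `C_n`, for `i ≠ j`, with root `e_i - e_j`, which permutes
the `i`th and `j`th coordinates. -/
def permuteReflection {n : ℕ} (i j : Fin n) : hyperoctahedral n :=
  ⟨rootReflection (EuclideanSpace.single i (1 : ℝ) - EuclideanSpace.single j (1 : ℝ)), by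
    refine mem_hyperoctahedral_of_single fun k => ?_
    by_cases hi : k = i
    · rw [hi]
      exact ⟨j, Or.inl (rootReflection_sub_single i j)⟩
    by_cases hj : k = j
    · refine ⟨i, Or.inl ?_⟩
      have h := congrArg (rootReflection (EuclideanSpace.single i (1 : ℝ) -
        EuclideanSpace.single j (1 : ℝ))) (rootReflection_sub_single i j)
      rw [rootReflection_rootReflection] at h
      rw [hj]
      exact h.symm
    · refine ⟨k, Or.inl (Submodule.reflection_mem_subspace_eq_self ?_)⟩
      rw [Submodule.mem_orthogonal_singleton_iff_inner_right]
      simp [inner_sub_left, EuclideanSpace.inner_single_left, Ne.symm hi, Ne.symm hj]⟩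

/-- The probability that the element `g` of the finite group `G` lies in the kernel of an
endomorphism of `G` drawn uniformly at random from the finite set of all endomorphisms of `G`. -/
def probMemKer (G : Type) [Group G] [Finite G] (g : G) : ℝ :=
  (Nat.card {φ : G →* G // g ∈ φ.ker} : ℝ) / (Nat.card (G →* G) : ℝ)

end

/-!
Write `Cₙ` as the semidirect product of the sign vectors `(ℤˣ)ⁿ` by `Sₙ`. An endomorphism that is
not injective on `Sₙ` kills the alternating group, hence factors through the product of the signs
and the sign of the permutation, so there are at most `|Hom(ℤˣ × ℤˣ, Cₙ)|` of these. A homomorphism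
`Γ → Sₙ` is determined by the idempotent map that sends each `i` to a representative of its orbit,
which has at least `n / |Γ|` fixed points, together with boundedly many choices for each `i`. Hence
`|Hom(ℤˣ × ℤˣ, Cₙ)|` is `o(n!)`, whereas conjugation by permutations alone gives `n!` endomorphisms.
So a random endomorphism is injective on `Sₙ` with probability tending to one, and then no
transposition lies in its kernel.

Let `ψ : Sₙ → Cₙ` be injective. The kernel of its composite with `Cₙ → Sₙ` is an abelian normal
subgroup of `Sₙ`, hence trivial, and for `n ≠ 6` all automorphisms of `Sₙ` are inner, so `ψ` is
conjugation by some `τ` up to signs. Every extension of `ψ` to `Cₙ` maps sign vectors to sign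
vectors, because their images in `Sₙ` again form an abelian normal subgroup. Up to `τ`, the
extensions of `ψ` are therefore the `Sₙ`-equivariant endomorphisms of `(ℤˣ)ⁿ`, of which there are
four, `v ↦ v ^ a * (∏ i, v i) ^ b` with `a` and `b` modulo `2`. Exactly one of these, the trivial
one, kills a sign change.
-/

section InnerAutomorphisms

open Equiv Equiv.Perm MulAction
open scoped Pointwise

/-- The two sides are half the orders of the centralizers of a product of `j + 1` disjoint
transpositions and of a single transposition in the symmetric group on `2 * (j + 1) + m` letters.
They are equal for `j = 2` and `m = 0`, the case behind the outer automorphism of `S₆`. -/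
theorem two_pow_mul_factorial_mul_factorial_lt {j m : ℕ} (hj : 1 ≤ j) (hjm : 1 ≤ m ∨ 3 ≤ j) :
    2 ^ j * (j + 1).factorial * m.factorial < (2 * j + m).factorial := by
  have lt_succ {j : ℕ} (hj : 1 ≤ j)
      (ih : 2 ^ j * (j + 1).factorial * m.factorial < (2 * j + m).factorial) :
      2 ^ (j + 1) * (j + 2).factorial * m.factorial < (2 * (j + 1) + m).factorial := calc
    _ = 2 * (j + 2) * (2 ^ j * (j + 1).factorial * m.factorial) := by
      rw [pow_succ, Nat.factorial_succ (j + 1)]; ring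
    _ < (2 * j + m + 2) * (2 * j + m + 1) * (2 * j + m).factorial :=
      Nat.mul_lt_mul_of_le_of_lt (by nlinarith) ih (by positivity)
    _ = _ := by
      rw [show 2 * (j + 1) + m = 2 * j + m + 1 + 1 by ring, Nat.factorial_succ,
        Nat.factorial_succ]; ring
  rcases m.eq_zero_or_pos with rfl | hm
  · have hj : 3 ≤ j := hjm.resolve_left (by decide)
    induction j, hj using Nat.le_induction with
    | base => decide
    | succ j hj ih => exact lt_succ (by omega) (ih (by omega) (by omega))
  · clear hjm
    induction j, hj using Nat.le_induction with
    | base =>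
      calc 2 ^ 1 * (1 + 1).factorial * m.factorial
        _ = 4 * m.factorial := by norm_num
        _ < (m + 2) * (m + 1) * m.factorial :=
          Nat.mul_lt_mul_of_pos_right (by nlinarith) m.factorial_pos
        _ = (2 * 1 + m).factorial := by
          rw [add_comm (2 * 1), Nat.factorial_succ, Nat.factorial_succ, mul_assoc]
    | succ j hj ih => exact lt_succ hj ih

theorem mul_lt_add_choose (a b : ℕ) : a * b < (a + b).choose a := by
  induction a generalizing b with
  | zero => simp
  | succ a iha =>
    induction b with
    | zero => simp
    | succ b ihb =>
      have := iha (b + 1)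
      rw [show a + 1 + (b + 1) = a + (b + 1) + 1 by ring, Nat.choose_succ_succ']
      rw [show a + 1 + b = a + (b + 1) by ring] at ihb
      nlinarith [Nat.zero_le (a * b)]

variable {X : Type*}

theorem stabilizer_perm_injective (hX : 3 ≤ Nat.card X) :
    Function.Injective (stabilizer (Perm X) : X → Subgroup (Perm X)) := by
  classical
  intro x y h
  by_contra hxy
  obtain ⟨z, hz⟩ : ∃ z, z ∉ ({x, y} : Set X) := by
    by_contra! hz
    have := Set.ncard_pair hxy
    rw [Set.eq_univ_of_forall hz, Set.ncard_univ] at this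
    omega
  simp only [Set.mem_insert_iff, Set.mem_singleton_iff, not_or] at hz
  have swap_mem : swap y z ∈ stabilizer (Perm X) y :=
    h ▸ swap_apply_of_ne_of_ne hxy (Ne.symm hz.1)
  exact hz.2 ((swap_apply_left y z).symm.trans swap_mem)

theorem nat_card_centralizer_of_cycleType_eq_replicate_two [Fintype X] [DecidableEq X]
    {σ : Perm X} {k : ℕ} (h : σ.cycleType = Multiset.replicate k 2) :
    Nat.card (Subgroup.centralizer {σ}) =
      (Nat.card X - 2 * k).factorial * 2 ^ k * k.factorial := by
  rw [Equiv.Perm.nat_card_centralizer, h, Nat.card_eq_fintype_card]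
  rcases k.eq_zero_or_pos with rfl | hk
  · simp
  · simp [Multiset.toFinset_replicate, hk.ne', mul_comm k 2]

variable [Finite X]

theorem isSwap_mulAut_apply [DecidableEq X] (hX : Nat.card X ≠ 6) (α : MulAut (Perm X))
    {σ : Perm X} (hσ : σ.IsSwap) : (α σ).IsSwap := by
  have := Fintype.ofFinite X
  rw [isSwap_iff_cycleType] at hσ ⊢
  have orderOf_map : orderOf (α σ) = 2 := by
    rw [MulEquiv.orderOf_eq, ← lcm_cycleType, hσ, Multiset.lcm_singleton]; rfl
  obtain ⟨j, hj⟩ := cycleType_prime_order (σ := α σ) (orderOf_map ▸ Nat.prime_two)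
  rw [orderOf_map] at hj
  have card_centralizer_map :
      Nat.card (Subgroup.centralizer {α σ}) = Nat.card (Subgroup.centralizer {σ}) := by
    refine Nat.card_congr (α.toEquiv.subtypeEquiv fun τ => ?_).symm
    simp [Subgroup.mem_centralizer_singleton_iff, ← map_mul]
  rw [nat_card_centralizer_of_cycleType_eq_replicate_two hj,
    nat_card_centralizer_of_cycleType_eq_replicate_two (k := 1) hσ] at card_centralizer_map
  obtain ⟨m, hm⟩ : ∃ m, Nat.card X = 2 * (j + 1) + m := by
    refine Nat.exists_eq_add_of_le ?_
    have := (sum_cycleType (α σ)).trans_le (Finset.card_le_univ _)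
    rwa [hj, Multiset.sum_replicate, smul_eq_mul, mul_comm, ← Nat.card_eq_fintype_card] at this
  rw [hm, show 2 * (j + 1) + m - 2 * (j + 1) = m by omega,
    show 2 * (j + 1) + m - 2 * 1 = 2 * j + m by omega] at card_centralizer_map
  rcases j.eq_zero_or_pos with rfl | hj'
  · exact hj
  exfalso
  rcases em (j = 1 ∧ m = 0) with ⟨rfl, rfl⟩ | hjm
  · norm_num [Nat.factorial] at card_centralizer_map
  · have := two_pow_mul_factorial_mul_factorial_lt hj' (m := m) (by omega)
    simp only [pow_succ, pow_zero, one_mul, Nat.factorial_one, mul_one] at card_centralizer_map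
    linarith

theorem stabilizer_eq_closure_isSwap [DecidableEq X] (x : X) :
    stabilizer (Perm X) x = Subgroup.closure {σ | σ.IsSwap ∧ σ x = x} := by
  refine le_antisymm (fun (f : Perm X) (hf : f x = x) => ?_)
    ((Subgroup.closure_le _).2 fun σ hσ => hσ.2)
  rw [mem_closure_isSwap fun σ hσ => hσ.1]
  refine ⟨Set.toFinite _, fun y => ?_⟩
  by_cases hy : f y = y
  · rw [hy]
    exact mem_orbit_self y
  · have hyx : y ≠ x := by rintro rfl; exact hy hf
    have hfyx : f y ≠ x := fun h => hyx (f.injective (h.trans hf.symm))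
    exact ⟨⟨swap y (f y), Subgroup.subset_closure
      ⟨⟨y, f y, Ne.symm hy, rfl⟩, swap_apply_of_ne_of_ne hyx.symm hfyx.symm⟩⟩,
      swap_apply_left y (f y)⟩

theorem not_isPretransitive_map_stabilizer [Nontrivial X] (hX : Nat.card X ≠ 6)
    (α : MulAut (Perm X)) (x : X) :
    ¬ IsPretransitive ((stabilizer (Perm X) x).map α.toMonoidHom) X := by
  classical
  intro h
  rw [stabilizer_eq_closure_isSwap, MonoidHom.map_closure] at h
  have map_eq_top := closure_of_isSwap_of_isPretransitive
    (S := α.toMonoidHom '' {σ | σ.IsSwap ∧ σ x = x})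
    (by rintro _ ⟨σ, hσ, rfl⟩; exact isSwap_mulAut_apply hX α hσ.1)
  rw [← MonoidHom.map_closure, ← stabilizer_eq_closure_isSwap,
    ← Subgroup.map_top_of_surjective α.toMonoidHom α.surjective] at map_eq_top
  exact (IsPreprimitive.isCoatom_stabilizer_of_isPreprimitive (G := Perm X) x).1
    (Subgroup.map_injective (f := α.toMonoidHom) α.injective map_eq_top)

theorem exists_map_stabilizer_eq_stabilizer_set [Nontrivial X] (hX : Nat.card X ≠ 6)
    (α : MulAut (Perm X)) (x : X) :
    ∃ s : Set X, s.Nonempty ∧ sᶜ.Nonempty ∧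
      (stabilizer (Perm X) x).map α.toMonoidHom = stabilizer (Perm X) s := by
  set H := (stabilizer (Perm X) x).map α.toMonoidHom
  have isCoatom_H : IsCoatom H := (OrderIso.isCoatom_iff α.mapSubgroup _).2
    (IsPreprimitive.isCoatom_stabilizer_of_isPreprimitive (G := Perm X) x)
  have compl_nonempty : (orbit H x)ᶜ.Nonempty := by
    refine Set.nonempty_compl.2 fun h => not_isPretransitive_map_stabilizer hX α x
      ((isPretransitive_iff_orbit_eq_univ x).2 h)
  have le_stabilizer : H ≤ stabilizer (Perm X) (orbit H x) :=
    fun h hh => smul_orbit (⟨h, hh⟩ : H) x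
  have stabilizer_ne_top :=
    stabilizer_ne_top_of_nonempty_of_nonempty_compl (nonempty_orbit x) compl_nonempty
  exact ⟨orbit H x, nonempty_orbit x, compl_nonempty,
    ((isCoatom_H.le_iff_eq stabilizer_ne_top).1 le_stabilizer).symm⟩

theorem index_stabilizer_set (s : Set X) :
    (stabilizer (Perm X) s).index = (Nat.card X).choose s.ncard := by
  classical
  let t : Set.powersetCard X s.ncard :=
    ⟨s.toFinite.toFinset, (Set.ncard_eq_toFinset_card s).symm⟩
  have : IsPretransitive (Perm X) (Set.powersetCard X s.ncard) :=
    Set.powersetCard.isPretransitive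
  have coe_t : (t : Set X) = s := s.toFinite.coe_toFinset
  rw [← Set.powersetCard.card, ← index_stabilizer_of_transitive (Perm X) t,
    Set.powersetCard.stabilizer_coe, coe_t]

theorem exists_map_stabilizer_eq_stabilizer [Nontrivial X] (hX : Nat.card X ≠ 6)
    (α : MulAut (Perm X)) (x : X) :
    ∃ y : X, (stabilizer (Perm X) x).map α.toMonoidHom = stabilizer (Perm X) y := by
  obtain ⟨s, hs, hsc, h⟩ := exists_map_stabilizer_eq_stabilizer_set hX α x
  have card_eq : s.ncard + sᶜ.ncard = Nat.card X := Set.ncard_add_ncard_compl s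
  have choose_eq : (s.ncard + sᶜ.ncard).choose s.ncard = s.ncard + sᶜ.ncard := by
    rw [card_eq, ← index_stabilizer_set, ← h, ← index_stabilizer_of_transitive (Perm X) x]
    exact Subgroup.index_map_equiv _ α
  have := mul_lt_add_choose s.ncard sᶜ.ncard
  have := hs.ncard_pos
  have := hsc.ncard_pos
  obtain card_eq_one | card_eq_one : s.ncard = 1 ∨ sᶜ.ncard = 1 := by
    by_contra! hne
    have : 2 ≤ s.ncard := by omega
    have : 2 ≤ sᶜ.ncard := by omega
    nlinarith
  · obtain ⟨y, rfl⟩ := Set.ncard_eq_one.1 card_eq_one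
    exact ⟨y, by rw [h, stabilizer_singleton]⟩
  · obtain ⟨y, hy⟩ := Set.ncard_eq_one.1 card_eq_one
    exact ⟨y, by rw [h, ← stabilizer_compl, hy, stabilizer_singleton]⟩

theorem mulAut_perm_eq_one (hX : Nat.card X ≤ 2) (α : MulAut (Perm X)) : α = 1 := by
  ext1 σ
  by_contra hσ
  have card_le : Nat.card (Perm X) ≤ 2 := Nat.card_perm.trans_le (Nat.factorial_le hX)
  have hσ1 : σ ≠ 1 := by rintro rfl; exact hσ (map_one α)
  have hασ1 : α σ ≠ 1 := (MulEquiv.map_ne_one_iff α).2 hσ1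
  have := Set.ncard_le_card ({1, σ, α σ} : Set (Perm X))
  rw [Set.ncard_eq_three.2 ⟨1, σ, α σ, hσ1.symm, hασ1.symm, Ne.symm hσ, rfl⟩] at this
  omega

theorem exists_eq_mulAut_conj (hX : Nat.card X ≠ 6) (α : MulAut (Perm X)) :
    ∃ τ : Perm X, α = MulAut.conj τ := by
  rcases le_or_gt (Nat.card X) 2 with h2 | h3
  · exact ⟨1, by rw [map_one, mulAut_perm_eq_one h2 α]⟩
  have : Nontrivial X := Finite.one_lt_card_iff_nontrivial.1 (by omega)
  choose f hf using exists_map_stabilizer_eq_stabilizer hX α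
  have f_injective : Function.Injective f := fun x y hxy =>
    stabilizer_perm_injective h3 (Subgroup.map_injective (f := α.toMonoidHom) α.injective
      (by rw [hf, hf, hxy]))
  have f_apply (σ : Perm X) (x : X) : f (σ x) = α σ (f x) := by
    apply stabilizer_perm_injective h3
    rw [← hf, ← Perm.smul_def σ, stabilizer_smul_eq_stabilizer_map_conj, ← Perm.smul_def (α σ),
      stabilizer_smul_eq_stabilizer_map_conj, ← hf, Subgroup.map_map, Subgroup.map_map]
    congr 1
    ext τ : 1
    simp
  refine ⟨Equiv.ofBijective f (Finite.injective_iff_bijective.1 f_injective),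
    MulEquiv.ext fun σ => ?_⟩
  rw [MulAut.conj_apply, eq_mul_inv_iff_mul_eq]
  ext x
  simp [f_apply]

end InnerAutomorphisms

noncomputable section

section CountingPermutationRepresentations

open Equiv MulAction

variable {Γ X : Type*} [Group Γ]

/-- A chosen representative of the orbit of `i` under the action `ψ` of `Γ`. The map
`i ↦ orbitRep ψ i` is idempotent, and its fixed points correspond to the orbits. -/
def orbitRep (ψ : Γ →* Perm X) (i : X) : X :=
  Quotient.out (s := orbitRel ψ.range X) ⟦i⟧

theorem orbitRep_apply (ψ : Γ →* Perm X) (g : Γ) (i : X) :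
    orbitRep ψ (ψ g i) = orbitRep ψ i :=
  congrArg Quotient.out (Quotient.sound ⟨⟨ψ g, g, rfl⟩, rfl⟩)

theorem exists_apply_orbitRep (ψ : Γ →* Perm X) (i : X) : ∃ g, ψ g (orbitRep ψ i) = i := by
  have out_related := Quotient.mk_out (s := orbitRel ψ.range X) i
  obtain ⟨⟨_, g, rfl⟩, hg⟩ := (orbitRel ψ.range X).symm out_related
  exact ⟨g, hg⟩

/-- A chosen element of `Γ` that carries the representative of the orbit of `i` to `i`. -/
def orbitLabel (ψ : Γ →* Perm X) (i : X) : Γ :=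
  (exists_apply_orbitRep ψ i).choose

theorem apply_orbitLabel_orbitRep (ψ : Γ →* Perm X) (i : X) :
    ψ (orbitLabel ψ i) (orbitRep ψ i) = i :=
  (exists_apply_orbitRep ψ i).choose_spec

theorem orbitRep_orbitRep (ψ : Γ →* Perm X) (i : X) :
    orbitRep ψ (orbitRep ψ i) = orbitRep ψ i := by
  conv_rhs => rw [← apply_orbitLabel_orbitRep ψ i, orbitRep_apply]

theorem eq_of_orbitRep_eq_of_orbitLabel_eq {ψ : Γ →* Perm X} {i j : X}
    (hrep : orbitRep ψ i = orbitRep ψ j) (hlabel : orbitLabel ψ i = orbitLabel ψ j) : i = j := by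
  rw [← apply_orbitLabel_orbitRep ψ i, ← apply_orbitLabel_orbitRep ψ j, hrep, hlabel]

theorem orbitRep_orbitLabel_injective :
    Function.Injective fun ψ : Γ →* Perm X =>
      (orbitRep ψ, fun (g : Γ) (i : X) => orbitLabel ψ (ψ g i)) := by
  intro ψ χ h
  obtain ⟨hrep, hlabel⟩ := Prod.mk.inj h
  have label_eq : orbitLabel ψ = orbitLabel χ := by simpa using congrFun hlabel 1
  ext g i
  refine eq_of_orbitRep_eq_of_orbitLabel_eq (ψ := ψ) ?_ ?_
  · rw [orbitRep_apply, hrep, orbitRep_apply]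
  · rw [congrFun₂ hlabel g i, label_eq]

variable [Finite X]

theorem card_le_card_mul_ncard_fixedPoints_orbitRep [Finite Γ] (ψ : Γ →* Perm X) :
    Nat.card X ≤ Nat.card Γ * (Function.fixedPoints (orbitRep ψ)).ncard := by
  rw [mul_comm, ← Nat.card_coe_set_eq, ← Nat.card_prod]
  refine Nat.card_le_card_of_injective
    (fun i => (⟨orbitRep ψ i, orbitRep_orbitRep ψ i⟩, orbitLabel ψ i)) fun i j h => ?_
  exact eq_of_orbitRep_eq_of_orbitLabel_eq (congrArg (fun p => p.1.1) h) (congrArg Prod.snd h)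

theorem ncard_setOf_subset_fixedPoints (s : Set X) :
    {f : X → X | s ⊆ Function.fixedPoints f}.ncard = Nat.card X ^ (Nat.card X - s.ncard) := by
  classical
  have fixes_iff (f : X → X) :
      f ∘ (Subtype.val : s → X) = Subtype.val ↔ s ⊆ Function.fixedPoints f :=
    ⟨fun h i hi => congrFun h ⟨i, hi⟩, fun h => funext fun i => h i.2⟩
  rw [← Nat.card_coe_set_eq, Set.coe_ofPred, ← Set.ncard_compl, ← Nat.card_coe_set_eq sᶜ,
    ← Nat.card_fun]
  exact Nat.card_congr ((Equiv.subtypeEquivRight fun f => (fixes_iff f).symm).trans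
    (Equiv.subtypePreimage (· ∈ s) Subtype.val))

theorem ncard_setOf_le_ncard_fixedPoints (k : ℕ) :
    {f : X → X | k ≤ (Function.fixedPoints f).ncard}.ncard ≤
      2 ^ Nat.card X * Nat.card X ^ (Nat.card X - k) := by
  classical
  have := Fintype.ofFinite X
  have fiber_le (s : Set X) (hs : k ≤ s.ncard) :
      {f : X → X | Function.fixedPoints f = s}.ncard ≤ Nat.card X ^ (Nat.card X - k) := by
    have fixes_of_eq : {f : X → X | Function.fixedPoints f = s} ⊆
        {f | s ⊆ Function.fixedPoints f} := fun _ hf => hf.ge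
    refine (Set.ncard_le_ncard fixes_of_eq).trans ?_
    rw [ncard_setOf_subset_fixedPoints]
    rcases (Nat.card X).eq_zero_or_pos with h0 | hpos
    · rw [h0, Nat.zero_sub, Nat.zero_sub]
    · exact Nat.pow_le_pow_right hpos (by omega)
  rw [Set.ncard_eq_toFinset_card', mul_comm]
  refine (Finset.card_le_mul_card_image (f := Function.fixedPoints) _ _ fun s hs => ?_).trans
    (Nat.mul_le_mul_left _ ((Finset.card_le_univ _).trans_eq (by simp)))
  obtain ⟨f, hf, rfl⟩ := Finset.mem_image.1 hs
  rw [← Set.ncard_coe_finset]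
  exact (Set.ncard_le_ncard fun f' hf' => (Finset.mem_filter.1 hf').2).trans
    (fiber_le _ (by simpa using hf))

theorem card_monoidHom_perm_le (Γ X : Type*) [Group Γ] [Finite Γ] [Finite X] :
    Nat.card (Γ →* Perm X) ≤ 2 ^ Nat.card X *
      Nat.card X ^ (Nat.card X - Nat.card X ⌈/⌉ Nat.card Γ) *
        (Nat.card Γ ^ Nat.card X) ^ Nat.card Γ := by
  rw [← Nat.card_fun, ← Nat.card_fun]
  refine le_trans ?_ (Nat.mul_le_mul_right _ (ncard_setOf_le_ncard_fixedPoints _))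
  rw [← Nat.card_coe_set_eq, ← Nat.card_prod]
  refine Nat.card_le_card_of_injective (fun ψ => (⟨orbitRep ψ,
    (ceilDiv_le_iff_le_mul Nat.card_pos).2 (card_le_card_mul_ncard_fixedPoints_orbitRep ψ)⟩,
    fun g i => orbitLabel ψ (ψ g i))) fun ψ χ h => ?_
  obtain ⟨hrep, hlabel⟩ := Prod.mk.inj h
  exact orbitRep_orbitLabel_injective (Prod.ext (Subtype.mk.inj hrep) hlabel)

/-- This is the bound `|Hom(Γ, Sₙ)| ≤ exp(O(n)) * n ^ (n - n / |Γ|)`, raised to the power `|Γ|` and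
with both sides moved so that neither division nor subtraction occurs. -/
theorem card_monoidHom_perm_pow_mul_le (Γ X : Type*) [Group Γ] [Finite Γ] [Finite X] :
    Nat.card (Γ →* Perm X) ^ Nat.card Γ * Nat.card X ^ Nat.card X ≤
      (2 * Nat.card Γ ^ Nat.card Γ * Nat.card X) ^ (Nat.card X * Nat.card Γ) := by
  set n := Nat.card X
  set g := Nat.card Γ
  have g_pos : 0 < g := Nat.card_pos
  set k := n ⌈/⌉ g
  have n_le : n ≤ g * k := (ceilDiv_le_iff_le_mul g_pos).1 le_rfl
  have k_le : k ≤ n := (ceilDiv_le_iff_le_mul g_pos).2 (Nat.le_mul_of_pos_left n g_pos)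
  have exponent_le : (n - k) * g + n ≤ n * g := by
    nlinarith [Nat.sub_add_cancel k_le]
  have pow_le : n ^ ((n - k) * g + n) ≤ n ^ (n * g) := by
    rcases n.eq_zero_or_pos with h0 | hpos
    · simp [h0]
    · exact Nat.pow_le_pow_right hpos exponent_le
  calc Nat.card (Γ →* Perm X) ^ g * n ^ n
    _ ≤ (2 ^ n * n ^ (n - k) * (g ^ n) ^ g) ^ g * n ^ n := by
      gcongr
      exact card_monoidHom_perm_le Γ X
    _ = (2 * g ^ g) ^ (n * g) * n ^ ((n - k) * g + n) := by
      ring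
    _ ≤ (2 * g ^ g) ^ (n * g) * n ^ (n * g) := by gcongr
    _ = (2 * g ^ g * n) ^ (n * g) := (mul_pow _ _ _).symm

instance finite_monoidHom (Γ G : Type*) [Group Γ] [Group G] [Finite Γ] [Finite G] :
    Finite (Γ →* G) :=
  DFunLike.finite _

theorem card_monoidHom_semidirectProduct_le (Γ : Type*) {N G : Type*} [Group Γ] [Group N] [Group G]
    [Finite Γ] [Finite N] [Finite G] (φ : G →* MulAut N) :
    Nat.card (Γ →* N ⋊[φ] G) ≤ Nat.card N ^ Nat.card Γ * Nat.card (Γ →* G) := by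
  rw [← Nat.card_fun, ← Nat.card_prod]
  refine Nat.card_le_card_of_injective
    (fun f => (fun g => (f g).left, SemidirectProduct.rightHom.comp f)) fun f f' h => ?_
  obtain ⟨hl, hr⟩ := Prod.mk.inj h
  exact MonoidHom.ext fun g => SemidirectProduct.ext (congrFun hl g) (DFunLike.congr_fun hr g)

theorem pow_self_le_exp_pow_mul_factorial (n : ℕ) :
    (n : ℝ) ^ n ≤ Real.exp 1 ^ n * n.factorial := by
  rw [← Real.exp_nat_mul, mul_one, ← div_le_iff₀ (by positivity)]
  exact Real.pow_div_factorial_le_exp _ n.cast_nonneg n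

theorem tendsto_div_factorial_of_pow_mul_pow_self_le {u : ℕ → ℕ} {C g : ℕ} (hg : g ≠ 0)
    (hu : ∀ n, u n ^ g * n ^ n ≤ (C * n) ^ (n * g)) :
    Tendsto (fun n => (u n : ℝ) / n.factorial) atTop (𝓝 0) := by
  have pow_le (n : ℕ) : ((u n : ℝ) / n.factorial) ^ g ≤
      ((C * Real.exp 1) ^ g) ^ n / n.factorial := by
    rw [div_pow, div_le_div_iff₀ (by positivity) (by positivity)]
    calc (u n : ℝ) ^ g * n.factorial
      _ ≤ (u n : ℝ) ^ g * (n : ℝ) ^ n := by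
        gcongr
        exact_mod_cast n.factorial_le_pow
      _ ≤ (C * n : ℝ) ^ (n * g) := mod_cast hu n
      _ = (C : ℝ) ^ (n * g) * ((n : ℝ) ^ n) ^ g := by rw [mul_pow, pow_mul (n : ℝ)]
      _ ≤ (C : ℝ) ^ (n * g) * (Real.exp 1 ^ n * n.factorial) ^ g := by
        gcongr
        exact pow_self_le_exp_pow_mul_factorial n
      _ = ((C * Real.exp 1) ^ g) ^ n * (n.factorial : ℝ) ^ g := by ring
  have pow_tendsto : Tendsto (fun n => ((u n : ℝ) / n.factorial) ^ g) atTop (𝓝 0) :=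
    squeeze_zero (fun n => by positivity) pow_le
      (FloorSemiring.tendsto_pow_div_factorial_atTop _)
  have := pow_tendsto.rpow_const (p := (g : ℝ)⁻¹) (Or.inr (by positivity))
  rw [Real.zero_rpow (by positivity)] at this
  exact this.congr fun n => Real.pow_rpow_inv_natCast (by positivity) hg

end CountingPermutationRepresentations

section Probability

theorem probMemKer_nonneg {G : Type} [Group G] [Finite G] (g : G) : 0 ≤ probMemKer G g :=
  div_nonneg (Nat.cast_nonneg _) (Nat.cast_nonneg _)

theorem probMemKer_eq_of_isConj {G : Type} [Group G] [Finite G] {g h : G} (hgh : IsConj g h) :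
    probMemKer G g = probMemKer G h := by
  obtain ⟨c, rfl⟩ := isConj_iff.1 hgh
  simp only [probMemKer, MonoidHom.mem_ker, map_mul, map_inv, conj_eq_one_iff]

theorem probMemKer_mulEquiv {G H : Type} [Group G] [Finite G] [Group H] [Finite H] (e : G ≃* H)
    (g : G) : probMemKer H (e g) = probMemKer G g := by
  let conj : (G →* G) ≃ (H →* H) := e.monoidHomCongrLeftEquiv.trans e.monoidHomCongrRightEquiv
  have mem_ker_iff (φ : G →* G) : g ∈ φ.ker ↔ e g ∈ (conj φ).ker := by
    simp [conj, MonoidHom.mem_ker]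
  rw [probMemKer, probMemKer, ← Nat.card_congr conj,
    ← Nat.card_congr (conj.subtypeEquiv mem_ker_iff)]

theorem abs_ncard_div_sub_inv_le {Ω : Type*} [Finite Ω] [Nonempty Ω] {F K : Set Ω} {m : ℕ}
    (hm : m ≠ 0) (hF : F.ncard = m * (F ∩ K).ncard) :
    |(K.ncard : ℝ) / Nat.card Ω - (m : ℝ)⁻¹| ≤ (Fᶜ.ncard : ℝ) / Nat.card Ω := by
  have card_eq : (Nat.card Ω : ℝ) = m * (F ∩ K).ncard + Fᶜ.ncard :=
    mod_cast hF ▸ (Set.ncard_add_ncard_compl F).symm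
  have ncard_eq : (K.ncard : ℝ) = (F ∩ K).ncard + (K \ F).ncard :=
    mod_cast Set.inter_comm K F ▸ (Set.ncard_inter_add_ncard_sdiff_eq_ncard K F).symm
  have diff_le : ((K \ F).ncard : ℝ) ≤ Fᶜ.ncard :=
    mod_cast Set.ncard_le_ncard fun _ h => h.2
  have one_le : (1 : ℝ) ≤ m := mod_cast Nat.one_le_iff_ne_zero.2 hm
  have card_pos : (0 : ℝ) < Nat.card Ω := mod_cast Nat.card_pos
  have difference_eq : (K.ncard : ℝ) / Nat.card Ω - (m : ℝ)⁻¹ =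
      ((K \ F).ncard - Fᶜ.ncard / m) / Nat.card Ω := by
    rw [ncard_eq]
    field_simp
    rw [card_eq]
    ring
  rw [difference_eq, abs_div, abs_of_pos card_pos]
  gcongr
  have div_le : (Fᶜ.ncard : ℝ) / m ≤ Fᶜ.ncard := div_le_self (by positivity) one_le
  have div_nonneg : 0 ≤ (Fᶜ.ncard : ℝ) / m := by positivity
  rw [abs_le]
  constructor <;> linarith

end Probability

section SignedPermutations

open Equiv SemidirectProduct

theorem ncard_preimage_eq_mul {α β : Type*} [Finite α] (f : α → β) {t : Set β} {k : ℕ}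
    (hk : ∀ b ∈ t, (f ⁻¹' {b}).ncard = k) : (f ⁻¹' t).ncard = t.ncard * k := by
  have fiberEquiv (b : t) : (f ⁻¹' {b.1} : Set α) ≃ Fin k := Finite.equivFinOfCardEq (hk b b.2)
  rw [← Nat.card_coe_set_eq, ← Nat.card_coe_set_eq, ← Nat.card_fin k, ← Nat.card_prod]
  exact Nat.card_congr ((Equiv.sigmaSubtypeFiberEquivSubtype f fun _ => Iff.rfl).symm.trans
    (Equiv.sigmaEquivProdOfEquiv fiberEquiv))

theorem normal_eq_bot_of_isMulCommutative {X : Type*} [Finite X] (hX : 5 ≤ Nat.card X)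
    (N : Subgroup (Perm X)) [N.Normal] [IsMulCommutative N] : N = ⊥ := by
  classical
  have := Fintype.ofFinite X
  by_contra hN
  have alternating_le : alternatingGroup X ≤ N :=
    Perm.alternatingGroup_le_of_normal hX ((Subgroup.nontrivial_iff_ne_bot N).2 hN)
  have : IsMulCommutative (alternatingGroup X) := ⟨⟨fun a b => Subtype.ext <|
    congrArg (Subtype.val : N → Perm X)
      (mul_comm' ⟨a, alternating_le a.2⟩ ⟨b, alternating_le b.2⟩)⟩⟩
  have := alternatingGroup.isMulCommutative_iff_card_le_three.1 this
  omega

/-- The action of the permutations of `X` on the sign vectors indexed by `X`. -/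
def permuteSigns (X : Type*) : Perm X →* MulAut (X → ℤˣ) :=
  mulAutArrow

theorem permuteSigns_apply {X : Type*} (σ : Perm X) (v : X → ℤˣ) (i : X) :
    permuteSigns X σ v i = v (σ⁻¹ i) :=
  rfl

theorem permuteSigns_mulSingle {X : Type*} [DecidableEq X] (σ : Perm X) (i : X) (u : ℤˣ) :
    permuteSigns X σ (Pi.mulSingle i u) = Pi.mulSingle (σ i) u := by
  ext j
  simp only [permuteSigns_apply, Pi.mulSingle_apply, Perm.inv_eq_iff_eq]

/-- The group of signed permutations of `X`. -/
abbrev SignedPerm (X : Type*) : Type _ :=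
  (X → ℤˣ) ⋊[permuteSigns X] Perm X

namespace SignedPerm

instance finite (X : Type*) [Finite X] : Finite (SignedPerm X) :=
  Finite.of_equiv _ equivProd.symm

theorem tendsto_card_monoidHom_div_factorial (Γ : Type*) [Group Γ] [Finite Γ] :
    Tendsto (fun n : ℕ => (Nat.card (Γ →* SignedPerm (Fin n)) : ℝ) / n.factorial) atTop (𝓝 0) := by
  set g := Nat.card Γ with hg
  refine tendsto_div_factorial_of_pow_mul_pow_self_le (C := 2 ^ g * (2 * g ^ g)) (g := g)
    Nat.card_pos.ne' fun n => ?_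
  have card_signs : Nat.card (Fin n → ℤˣ) = 2 ^ n := by
    simp [Nat.card_eq_fintype_card]
  have card_le := card_monoidHom_semidirectProduct_le Γ (permuteSigns (Fin n))
  have perm_le := card_monoidHom_perm_pow_mul_le Γ (Fin n)
  rw [Nat.card_fin, ← hg] at perm_le
  rw [card_signs, ← hg] at card_le
  calc Nat.card (Γ →* SignedPerm (Fin n)) ^ g * n ^ n
    _ ≤ ((2 ^ n) ^ g * Nat.card (Γ →* Perm (Fin n))) ^ g * n ^ n := by gcongr
    _ = (2 ^ g) ^ (n * g) * (Nat.card (Γ →* Perm (Fin n)) ^ g * n ^ n) := by ring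
    _ ≤ (2 ^ g) ^ (n * g) * (2 * g ^ g * n) ^ (n * g) := by gcongr
    _ = (2 ^ g * (2 * g ^ g) * n) ^ (n * g) := by rw [← mul_pow, ← mul_assoc]

/-- The sign change of the coordinate `i`. -/
def flip {X : Type*} [DecidableEq X] (i : X) : SignedPerm X :=
  inl (Pi.mulSingle i (-1))

theorem inr_mul_flip_mul_inr_inv {X : Type*} [DecidableEq X] (σ : Perm X) (i : X) :
    inr σ * flip i * (inr σ)⁻¹ = flip (σ i) := by
  rw [flip, flip, ← permuteSigns_mulSingle, inl_aut, map_inv]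

theorem flip_injective {X : Type*} [DecidableEq X] : Function.Injective (flip (X := X)) := by
  intro i j h
  by_contra hij
  have := congrFun (inl_injective h) i
  rw [Pi.mulSingle_eq_same, Pi.mulSingle_eq_of_ne hij] at this
  exact absurd this (by decide)

theorem factorial_le_card_monoidHom (X : Type*) [Finite X] :
    (Nat.card X).factorial ≤ Nat.card (SignedPerm X →* SignedPerm X) := by
  classical
  rw [← Nat.card_perm]
  refine Nat.card_le_card_of_injective
    (fun σ => (MulAut.conj (inr σ : SignedPerm X)).toMonoidHom) fun σ τ h => Equiv.ext fun i => ?_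
  have := DFunLike.congr_fun h (flip i)
  exact flip_injective (by simpa [inr_mul_flip_mul_inr_inv] using this)

section Endomorphisms

variable {X G : Type*} [Group G]

section Characters

variable [Fintype X]

/-- The product of all the entries of a sign vector. -/
def signProd : (X → ℤˣ) →* ℤˣ where
  toFun v := ∏ i, v i
  map_one' := Finset.prod_const_one
  map_mul' _ _ := Finset.prod_mul_distrib

theorem signProd_permuteSigns (σ : Perm X) (v : X → ℤˣ) :
    signProd (permuteSigns X σ v) = signProd v :=
  Equiv.prod_comp σ⁻¹ v

variable [DecidableEq X]

theorem signProd_mulSingle (i : X) (u : ℤˣ) : signProd (Pi.mulSingle i u) = u :=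
  (Finset.prod_pi_mulSingle' i u Finset.univ).trans (if_pos (Finset.mem_univ i))

/-- The two sign characters of a signed permutation: the product of its signs and the sign of its
underlying permutation. -/
def signCharacters : SignedPerm X →* ℤˣ × ℤˣ :=
  (SemidirectProduct.lift signProd 1 fun σ => by
    ext v
    simp [signProd_permuteSigns]).prod (Perm.sign.comp rightHom)

theorem signCharacters_apply (g : SignedPerm X) :
    signCharacters g = (signProd g.left, Perm.sign g.right) := by
  simp [signCharacters, SemidirectProduct.lift]

theorem signCharacters_surjective [Nontrivial X] :
    Function.Surjective (signCharacters (X := X)) := by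
  rintro ⟨a, b⟩
  obtain ⟨i⟩ : Nonempty X := inferInstance
  obtain ⟨σ, rfl⟩ := Perm.sign_surjective X b
  exact ⟨⟨Pi.mulSingle i a, σ⟩, by rw [signCharacters_apply, signProd_mulSingle]⟩

theorem map_inl_eq_of_alternatingGroup_le_ker (hX : 3 ≤ Nat.card X) {φ : SignedPerm X →* G}
    (hφ : alternatingGroup X ≤ (φ.comp inr).ker) (i : X) (v : X → ℤˣ) :
    φ (inl v) = φ (inl (Pi.mulSingle i (signProd v))) := by
  have := alternatingGroup.isPretransitive_of_three_le_card X hX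
  suffices φ.comp inl = (φ.comp inl).comp ((MonoidHom.mulSingle _ i).comp signProd) from
    DFunLike.congr_fun this v
  refine MonoidHom.pi_ext fun j u => ?_
  obtain ⟨⟨σ, hσ⟩, rfl⟩ := MulAction.exists_smul_eq (alternatingGroup X) i j
  have map_inr_eq_one : φ (inr σ) = 1 := hφ hσ
  change φ (inl (Pi.mulSingle (σ i) u)) = φ (inl (Pi.mulSingle i (signProd _)))
  rw [signProd_mulSingle, ← permuteSigns_mulSingle, inl_aut, map_mul, map_mul, map_inr_eq_one,
    one_mul, map_inv, map_inv, map_inr_eq_one, inv_one, mul_one]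

theorem ker_signCharacters_le_ker (hX : 3 ≤ Nat.card X) {φ : SignedPerm X →* G}
    (hφ : alternatingGroup X ≤ (φ.comp inr).ker) : signCharacters.ker ≤ φ.ker := by
  intro g hg
  rw [MonoidHom.mem_ker, signCharacters_apply, Prod.mk_eq_one] at hg
  obtain ⟨i⟩ : Nonempty X := (Nat.card_pos_iff.1 (by omega)).1
  have map_inr_eq_one : φ (inr g.right) = 1 := hφ hg.2
  rw [MonoidHom.mem_ker, ← inl_left_mul_inr_right g, map_mul, map_inr_eq_one,
    map_inl_eq_of_alternatingGroup_le_ker hX hφ i, hg.1, Pi.mulSingle_one, map_one, map_one,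
    mul_one]

end Characters

/-- The homomorphisms that are faithful on the permutations of the coordinates. Almost all
endomorphisms of `SignedPerm X` are of this kind when `X` is large. -/
def permFaithful (X G : Type*) [Group G] : Set (SignedPerm X →* G) :=
  {φ | Function.Injective (φ.comp inr)}

theorem alternatingGroup_le_ker_of_notMem_permFaithful [Fintype X] [DecidableEq X]
    (hX : 5 ≤ Nat.card X) {φ : SignedPerm X →* G} (hφ : φ ∉ permFaithful X G) :
    alternatingGroup X ≤ (φ.comp inr).ker :=
  Perm.alternatingGroup_le_of_normal hX <|
    (Subgroup.nontrivial_iff_ne_bot _).2 (mt (MonoidHom.ker_eq_bot_iff _).1 hφ)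

theorem ncard_compl_permFaithful_le [Finite X] [Finite G] (hX : 5 ≤ Nat.card X) :
    (permFaithful X G)ᶜ.ncard ≤ Nat.card (ℤˣ × ℤˣ →* G) := by
  classical
  have := Fintype.ofFinite X
  have : Nontrivial X := Finite.one_lt_card_iff_nontrivial.1 (by omega)
  rw [← Nat.card_congr (signCharacters.liftOfSurjective (signCharacters_surjective (X := X)))]
  exact Nat.card_le_card_of_injective (fun φ => ⟨φ.1, ker_signCharacters_le_ker (by omega)
    (alternatingGroup_le_ker_of_notMem_permFaithful hX φ.2)⟩)
    fun φ χ h => Subtype.ext (Subtype.mk.inj h)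

theorem conj_inl (g : SignedPerm X) (v : X → ℤˣ) :
    g * inl v * g⁻¹ = inl (permuteSigns X g.right v) := by
  ext
  · simp [mul_right_comm]
  · simp

section EquivariantEndomorphisms

/-- The endomorphisms of the group of sign vectors that commute with all permutations of the
coordinates. -/
def equivariantEnds (X : Type*) : Set ((X → ℤˣ) →* (X → ℤˣ)) :=
  {f | ∀ σ v, f (permuteSigns X σ v) = permuteSigns X σ (f v)}

theorem pow_mul_pow_signProd_mem_equivariantEnds [Fintype X] (k l : ℕ) :
    MonoidHom.id (X → ℤˣ) ^ k * ((Pi.constMonoidHom X ℤˣ).comp signProd) ^ l ∈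
      equivariantEnds X := by
  intro σ v
  ext i
  simp [permuteSigns_apply, signProd_permuteSigns]

theorem apply_mulSingle_apply_eq [DecidableEq X] {f : (X → ℤˣ) →* (X → ℤˣ)}
    (hf : f ∈ equivariantEnds X) (σ : Perm X) (i j : X) (u : ℤˣ) :
    f (Pi.mulSingle (σ i) u) (σ j) = f (Pi.mulSingle i u) j := by
  rw [← permuteSigns_mulSingle, hf, permuteSigns_apply, ← Perm.mul_apply, inv_mul_cancel,
    Perm.one_apply]

theorem bijOn_equivariantEnds [Finite X] [DecidableEq X] {x y : X} (hxy : x ≠ y) :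
    Set.BijOn (fun f : (X → ℤˣ) →* (X → ℤˣ) =>
      (f (Pi.mulSingle x (-1)) x, f (Pi.mulSingle x (-1)) y)) (equivariantEnds X) Set.univ := by
  have := Fintype.ofFinite X
  refine ⟨fun _ _ => Set.mem_univ _, fun f hf f' hf' h => ?_, fun ⟨a, b⟩ _ => ?_⟩
  · obtain ⟨diag_eq, off_diag_eq⟩ := Prod.mk.inj h
    have apply_flip (j : X) : f (Pi.mulSingle x (-1)) j = f' (Pi.mulSingle x (-1)) j := by
      rcases eq_or_ne j x with rfl | hj
      · exact diag_eq
      · have f_eq := apply_mulSingle_apply_eq hf (swap y j) x y (-1)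
        have f'_eq := apply_mulSingle_apply_eq hf' (swap y j) x y (-1)
        rw [swap_apply_of_ne_of_ne hxy hj.symm, swap_apply_left] at f_eq f'_eq
        exact f_eq.trans (off_diag_eq.trans f'_eq.symm)
    refine MonoidHom.pi_ext fun i u => funext fun j => ?_
    rcases Int.units_eq_one_or u with rfl | rfl
    · rw [Pi.mulSingle_one, map_one, map_one]
    · have f_eq := apply_mulSingle_apply_eq hf (swap x i) x (swap x i j) (-1)
      have f'_eq := apply_mulSingle_apply_eq hf' (swap x i) x (swap x i j) (-1)
      rw [swap_apply_left, swap_apply_self] at f_eq f'_eq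
      exact f_eq.trans ((apply_flip _).trans f'_eq.symm)
  · have exists_pow (u : ℤˣ) : ∃ k : ℕ, (-1) ^ k = u := by
      rcases Int.units_eq_one_or u with rfl | rfl
      exacts [⟨0, rfl⟩, ⟨1, rfl⟩]
    obtain ⟨k, hk⟩ := exists_pow (a * b)
    obtain ⟨l, hl⟩ := exists_pow b
    refine ⟨_, pow_mul_pow_signProd_mem_equivariantEnds k l, Prod.ext ?_ ?_⟩
    · simp [signProd_mulSingle, hk, hl, mul_assoc]
    · simp [signProd_mulSingle, hl, Pi.mulSingle_eq_of_ne hxy.symm]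

theorem ncard_equivariantEnds [Finite X] [Nontrivial X] : (equivariantEnds X).ncard = 4 := by
  classical
  obtain ⟨x, y, hxy⟩ := exists_pair_ne X
  have bij := bijOn_equivariantEnds hxy
  rw [← bij.injOn.ncard_image, bij.image_eq, Set.ncard_univ]
  simp

end EquivariantEndomorphisms

/-- The extension of a homomorphism `ψ : Perm X →* SignedPerm X`, which is assumed to be conjugation
by `τ` up to signs, to all signed permutations by means of an equivariant endomorphism. -/
def extend {ψ : Perm X →* SignedPerm X} {τ : Perm X} (hτ : ∀ σ, (ψ σ).right = τ * σ * τ⁻¹)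
    (f : equivariantEnds X) : SignedPerm X →* SignedPerm X :=
  SemidirectProduct.lift (inl.comp ((permuteSigns X τ).toMonoidHom.comp f)) ψ fun σ => by
    ext1 v
    change inl (permuteSigns X τ (f.1 (permuteSigns X σ v))) =
      ψ σ * inl (permuteSigns X τ (f.1 v)) * (ψ σ)⁻¹
    rw [conj_inl, hτ, f.2, ← MulAut.mul_apply, ← MulAut.mul_apply, ← map_mul, ← map_mul,
      inv_mul_cancel_right]

section Extend

variable {ψ : Perm X →* SignedPerm X} {τ : Perm X} (hτ : ∀ σ, (ψ σ).right = τ * σ * τ⁻¹)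

theorem extend_apply_inl (f : equivariantEnds X) (v : X → ℤˣ) :
    extend hτ f (inl v) = inl (permuteSigns X τ (f.1 v)) :=
  SemidirectProduct.lift_inl ..

theorem extend_comp_inr (f : equivariantEnds X) : (extend hτ f).comp inr = ψ :=
  SemidirectProduct.lift_comp_inr ..

theorem extend_injective : Function.Injective (extend hτ) := fun f f' h => by
  ext1
  ext1 v
  have := DFunLike.congr_fun h (inl v)
  rw [extend_apply_inl, extend_apply_inl] at this
  exact (permuteSigns X τ).injective (inl_injective this)

theorem exists_extend_eq {φ : SignedPerm X →* SignedPerm X} (hφ : φ.comp inr = ψ)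
    (hinl : ∀ v, φ (inl v) ∈ inl.range) : ∃ f, extend hτ f = φ := by
  choose f hf using hinl
  have f_mul (v w) : f (v * w) = f v * f w := by
    apply inl_injective (φ := permuteSigns X)
    rw [hf, map_mul, map_mul, map_mul, hf, hf]
  have f_permute (σ v) : f (permuteSigns X σ v) = permuteSigns X (τ * σ * τ⁻¹) (f v) := by
    apply inl_injective (φ := permuteSigns X)
    rw [hf, inl_aut, map_mul, map_mul, map_inv, map_inv, ← hf, ← hτ, ← conj_inl, ← hφ]
    rfl
  refine ⟨⟨(permuteSigns X τ⁻¹).toMonoidHom.comp (MonoidHom.mk' f f_mul), fun σ v => ?_⟩,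
    SemidirectProduct.hom_ext (MonoidHom.ext fun v => ?_) ((extend_comp_inr hτ _).trans hφ.symm)⟩
  · change permuteSigns X τ⁻¹ (f _) = permuteSigns X σ (permuteSigns X τ⁻¹ (f v))
    rw [f_permute, ← MulAut.mul_apply, ← MulAut.mul_apply, ← map_mul, ← map_mul, mul_assoc,
      inv_mul_cancel_left]
  · change extend hτ _ (inl v) = φ (inl v)
    rw [extend_apply_inl, ← hf]
    change inl (permuteSigns X τ (permuteSigns X τ⁻¹ (f v))) = _
    rw [← MulAut.mul_apply, ← map_mul, mul_inv_cancel, map_one, MulAut.one_apply]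

end Extend

section FaithfulEndomorphisms

variable [Finite X]

theorem eq_comp_rightHom_of_flip_mem_ker [DecidableEq X] {φ : SignedPerm X →* G} {i : X}
    (hφ : flip i ∈ φ.ker) : φ = (φ.comp inr).comp rightHom := by
  refine SemidirectProduct.hom_ext (MonoidHom.pi_ext fun j u => ?_) (MonoidHom.ext fun σ => rfl)
  change φ (inl (Pi.mulSingle j u)) = φ (inr (rightHom (inl _)))
  rw [rightHom_inl, map_one, map_one]
  rcases Int.units_eq_one_or u with rfl | rfl
  · rw [Pi.mulSingle_one, map_one, map_one]
  · change flip j ∈ φ.ker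
    rw [← swap_apply_left i j, ← inr_mul_flip_mul_inr_inv]
    exact φ.normal_ker.conj_mem _ hφ _

theorem ncard_permFaithful_inter_flip [DecidableEq X] (i : X) :
    (permFaithful X G ∩ {φ | flip i ∈ φ.ker}).ncard =
      {ψ : Perm X →* G | Function.Injective ψ}.ncard := by
  refine Set.ncard_congr (fun φ _ => φ.comp inr) (fun φ hφ => hφ.1) (fun φ χ hφ hχ h => ?_)
    fun ψ hψ => ⟨ψ.comp rightHom, ⟨hψ, ?_⟩, MonoidHom.ext fun σ => rfl⟩
  · rw [eq_comp_rightHom_of_flip_mem_ker hφ.2, h, ← eq_comp_rightHom_of_flip_mem_ker hχ.2]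
  · exact (congrArg ψ (rightHom_inl _)).trans ψ.map_one

theorem exists_right_apply_eq_conj (hX : 7 ≤ Nat.card X) {ψ : Perm X →* SignedPerm X}
    (hψ : Function.Injective ψ) : ∃ τ : Perm X, ∀ σ, (ψ σ).right = τ * σ * τ⁻¹ := by
  have ker_comm : IsMulCommutative (rightHom.comp ψ).ker := by
    refine ⟨⟨fun a b => Subtype.ext (hψ ?_)⟩⟩
    obtain ⟨v, hv⟩ : ψ a ∈ (inl : _ →* SignedPerm X).range :=
      range_inl_eq_ker_rightHom.ge a.2
    obtain ⟨w, hw⟩ : ψ b ∈ (inl : _ →* SignedPerm X).range :=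
      range_inl_eq_ker_rightHom.ge b.2
    change ψ (a * b) = ψ (b * a)
    rw [map_mul, map_mul, ← hv, ← hw, ← map_mul, ← map_mul, mul_comm]
  have injective : Function.Injective (rightHom.comp ψ) :=
    (MonoidHom.ker_eq_bot_iff _).1 (normal_eq_bot_of_isMulCommutative (by omega) _)
  obtain ⟨τ, hτ⟩ := exists_eq_mulAut_conj (by omega)
    (MulEquiv.ofBijective _ (Finite.injective_iff_bijective.1 injective))
  exact ⟨τ, DFunLike.congr_fun hτ⟩

theorem apply_inl_mem_range_inl (hX : 7 ≤ Nat.card X) {φ : SignedPerm X →* SignedPerm X}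
    (hφ : φ ∈ permFaithful X (SignedPerm X)) (v : X → ℤˣ) : φ (inl v) ∈ inl.range := by
  obtain ⟨τ, hτ⟩ := exists_right_apply_eq_conj hX hφ
  have surjective : Function.Surjective (rightHom.comp φ) := fun σ =>
    ⟨inr (τ⁻¹ * σ * τ), (hτ _).trans (by group)⟩
  have : (inl : _ →* SignedPerm X).range.Normal := by
    rw [range_inl_eq_ker_rightHom]
    infer_instance
  have : ((inl : _ →* SignedPerm X).range.map (rightHom.comp φ)).Normal :=
    this.map _ surjective
  have map_range_eq_bot : (inl : _ →* SignedPerm X).range.map (rightHom.comp φ) = ⊥ :=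
    normal_eq_bot_of_isMulCommutative (by omega) _
  rw [range_inl_eq_ker_rightHom, MonoidHom.mem_ker, ← Subgroup.mem_bot, ← map_range_eq_bot]
  exact ⟨inl v, ⟨v, rfl⟩, rfl⟩

theorem ncard_setOf_comp_inr_eq (hX : 7 ≤ Nat.card X) {ψ : Perm X →* SignedPerm X}
    (hψ : Function.Injective ψ) :
    {φ : SignedPerm X →* SignedPerm X | φ.comp inr = ψ}.ncard = 4 := by
  have : Nontrivial X := Finite.one_lt_card_iff_nontrivial.1 (by omega)
  obtain ⟨τ, hτ⟩ := exists_right_apply_eq_conj hX hψ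
  have range_extend : Set.range (extend hτ) = {φ | φ.comp inr = ψ} := by
    ext φ
    refine ⟨?_, fun hφ => exists_extend_eq hτ hφ (apply_inl_mem_range_inl hX ?_)⟩
    · rintro ⟨f, rfl⟩
      exact extend_comp_inr hτ f
    · rwa [← Set.mem_ofPred.1 hφ] at hψ
  rw [← range_extend, ← Nat.card_coe_set_eq, Nat.card_range_of_injective (extend_injective hτ),
    Nat.card_coe_set_eq, ncard_equivariantEnds]

theorem ncard_permFaithful (hX : 7 ≤ Nat.card X) :
    (permFaithful X (SignedPerm X)).ncard =
      4 * {ψ : Perm X →* SignedPerm X | Function.Injective ψ}.ncard := by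
  rw [mul_comm]
  exact ncard_preimage_eq_mul (fun φ : SignedPerm X →* SignedPerm X => φ.comp inr) fun ψ hψ =>
    ncard_setOf_comp_inr_eq hX hψ

end FaithfulEndomorphisms

end Endomorphisms

section KernelProbabilities

variable {X : Type} [Finite X]

theorem ncard_compl_permFaithful_div_le (hX : 5 ≤ Nat.card X) :
    ((permFaithful X (SignedPerm X))ᶜ.ncard : ℝ) / Nat.card (SignedPerm X →* SignedPerm X) ≤
      Nat.card (ℤˣ × ℤˣ →* SignedPerm X) / (Nat.card X).factorial := by
  gcongr
  · exact ncard_compl_permFaithful_le hX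
  · exact factorial_le_card_monoidHom X

theorem probMemKer_inr_le (hX : 5 ≤ Nat.card X) {σ : Perm X} (hσ : σ ≠ 1) :
    probMemKer (SignedPerm X) (inr σ) ≤
      Nat.card (ℤˣ × ℤˣ →* SignedPerm X) / (Nat.card X).factorial := by
  refine le_trans ?_ (ncard_compl_permFaithful_div_le hX)
  have mem_compl : {φ : SignedPerm X →* SignedPerm X | inr σ ∈ φ.ker} ⊆
      (permFaithful X (SignedPerm X))ᶜ := fun φ hφ hinj =>
    hσ (hinj (hφ.trans (map_one (φ.comp inr)).symm))
  exact div_le_div_of_nonneg_right (Nat.cast_le.2 (Set.ncard_le_ncard mem_compl))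
    (Nat.cast_nonneg _)

theorem abs_probMemKer_flip_sub_le [DecidableEq X] (hX : 7 ≤ Nat.card X) (i : X) :
    |probMemKer (SignedPerm X) (flip i) - 1 / 4| ≤
      Nat.card (ℤˣ × ℤˣ →* SignedPerm X) / (Nat.card X).factorial := by
  refine le_trans ?_ (ncard_compl_permFaithful_div_le (by omega))
  have ncard_eq : (permFaithful X (SignedPerm X)).ncard =
      4 * (permFaithful X (SignedPerm X) ∩ {φ | flip i ∈ φ.ker}).ncard := by
    rw [ncard_permFaithful hX, ncard_permFaithful_inter_flip]
  rw [one_div]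
  exact mod_cast abs_ncard_div_sub_inv_le four_ne_zero ncard_eq

end KernelProbabilities

section Isometries

variable {X : Type*} [Fintype X]

theorem cast_units_mul_self (u : ℤˣ) : ((u : ℤ) : ℝ) * ((u : ℤ) : ℝ) = 1 := by
  rw [← Int.cast_mul, Int.units_coe_mul_self, Int.cast_one]

/-- The representation of signed permutations by linear isometries, which permute the coordinates
and change signs. -/
def toIsometry : SignedPerm X →* (EuclideanSpace ℝ X ≃ₗᵢ[ℝ] EuclideanSpace ℝ X) where
  toFun g :=
    { toFun x := WithLp.toLp 2 fun i => ((g.left i : ℤ) : ℝ) * x (g.right⁻¹ i)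
      invFun x := WithLp.toLp 2 fun i => ((g.left (g.right i) : ℤ) : ℝ) * x (g.right i)
      map_add' x y := by ext i; simp [mul_add]
      map_smul' c x := by ext i; simp [mul_left_comm]
      left_inv x := by ext i; simp [← mul_assoc, cast_units_mul_self]
      right_inv x := by ext i; simp [← mul_assoc, cast_units_mul_self]
      norm_map' x := by
        have norm_sign (u : ℤˣ) : ‖((u : ℤ) : ℝ)‖ = 1 := by
          rw [Real.norm_eq_abs, ← Int.cast_abs, Int.isUnit_iff_abs_eq.1 u.isUnit, Int.cast_one]
        simp only [LinearEquiv.coe_mk, LinearMap.coe_mk, AddHom.coe_mk, EuclideanSpace.norm_eq,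
          norm_mul, norm_sign, one_mul]
        rw [Equiv.sum_comp g.right⁻¹ fun i => ‖x i‖ ^ 2] }
  map_one' := by
    ext x i
    change (((1 : SignedPerm X).left i : ℤ) : ℝ) * x ((1 : SignedPerm X).right⁻¹ i) = x i
    simp only [one_left, one_right, inv_one, Perm.one_apply, Pi.one_apply, Units.val_one,
      Int.cast_one, one_mul]
  map_mul' g h := by
    ext x i
    change (((g * h).left i : ℤ) : ℝ) * x ((g * h).right⁻¹ i) =
      ((g.left i : ℤ) : ℝ) * (((h.left (g.right⁻¹ i) : ℤ) : ℝ) * x (h.right⁻¹ (g.right⁻¹ i)))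
    simp only [mul_left, mul_right, Pi.mul_apply, permuteSigns_apply, mul_inv_rev,
      Perm.mul_apply, Units.val_mul, Int.cast_mul, mul_assoc]

theorem toIsometry_apply (g : SignedPerm X) (x : EuclideanSpace ℝ X) (i : X) :
    toIsometry g x i = ((g.left i : ℤ) : ℝ) * x (g.right⁻¹ i) :=
  rfl

theorem toIsometry_single [DecidableEq X] (g : SignedPerm X) (i : X) :
    toIsometry g (EuclideanSpace.single i 1) =
      ((g.left (g.right i) : ℤ) : ℝ) • EuclideanSpace.single (g.right i) 1 := by
  ext j
  rw [toIsometry_apply, PiLp.smul_apply, PiLp.single_apply, PiLp.single_apply, smul_eq_mul]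
  simp only [Perm.inv_eq_iff_eq]
  split_ifs with h
  · rw [h]
  · rw [mul_zero, mul_zero]

theorem linearIsometryEquiv_ext_single [DecidableEq X] {𝕜 E : Type*} [RCLike 𝕜]
    [SeminormedAddCommGroup E] [Module 𝕜 E] {w w' : EuclideanSpace 𝕜 X ≃ₗᵢ[𝕜] E}
    (h : ∀ i, w (EuclideanSpace.single i 1) = w' (EuclideanSpace.single i 1)) : w = w' :=
  (EuclideanSpace.basisFun X 𝕜).toBasis.ext_linearIsometryEquiv fun i => by simpa using h i

theorem toIsometry_injective : Function.Injective (toIsometry (X := X)) := by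
  classical
  refine (injective_iff_map_eq_one _).2 fun g hg => ?_
  have single_eq (i : X) : ((g.left (g.right i) : ℤ) : ℝ) • EuclideanSpace.single (g.right i) 1 =
      (EuclideanSpace.single i 1 : EuclideanSpace ℝ X) := by
    rw [← toIsometry_single, hg]
    rfl
  have right_eq (i : X) : g.right i = i := by
    by_contra hne
    simpa [hne] using congrArg (· (g.right i)) (single_eq i)
  refine SemidirectProduct.ext (funext fun i => ?_) (Equiv.ext right_eq)
  have left_eq := congrArg (· i) (single_eq i)
  rw [right_eq] at left_eq
  simpa using left_eq

theorem exists_toIsometry_eq [DecidableEq X]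
    {w : EuclideanSpace ℝ X ≃ₗᵢ[ℝ] EuclideanSpace ℝ X}
    (hw : ∀ i, ∃ (j : X) (u : ℤˣ), w (EuclideanSpace.single i 1) =
      ((u : ℤ) : ℝ) • EuclideanSpace.single j 1) : ∃ g, toIsometry g = w := by
  choose j u hw using hw
  have j_injective : Function.Injective j := by
    intro i k hik
    by_contra hne
    have inner_eq_zero : inner ℝ (w (EuclideanSpace.single i 1)) (w (EuclideanSpace.single k 1)) =
        0 := by
      simp [LinearIsometryEquiv.inner_map_map, EuclideanSpace.inner_single_left, hne]
    rw [hw, hw, hik, inner_smul_left, inner_smul_right] at inner_eq_zero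
    simp at inner_eq_zero
  let σ : Perm X := Equiv.ofBijective j (Finite.injective_iff_bijective.1 j_injective)
  refine ⟨⟨permuteSigns X σ u, σ⟩, linearIsometryEquiv_ext_single fun i => ?_⟩
  rw [hw, toIsometry_single]
  change ((u (σ⁻¹ (σ i)) : ℤ) : ℝ) • EuclideanSpace.single (σ i) 1 = _
  rw [← Perm.mul_apply, inv_mul_cancel, Perm.one_apply]
  rfl

end Isometries

section Hyperoctahedral

variable {n : ℕ}

theorem mem_signedBasis_iff {x : EuclideanSpace ℝ (Fin n)} :
    x ∈ signedBasis n ↔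
      ∃ (i : Fin n) (u : ℤˣ), x = ((u : ℤ) : ℝ) • EuclideanSpace.single i 1 := by
  refine exists_congr fun i => ⟨?_, ?_⟩
  · rintro (rfl | rfl)
    exacts [⟨1, by simp⟩, ⟨-1, by simp⟩]
  · rintro ⟨u, rfl⟩
    rcases Int.units_eq_one_or u with rfl | rfl
    exacts [Or.inl (by simp), Or.inr (by simp)]

theorem range_toIsometry : (toIsometry (X := Fin n)).range = hyperoctahedral n := by
  ext w
  refine ⟨?_, fun hw => exists_toIsometry_eq fun i => mem_signedBasis_iff.1 ?_⟩
  · rintro ⟨g, rfl⟩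
    exact mem_hyperoctahedral_of_single fun i =>
      mem_signedBasis_iff.2 ⟨_, _, toIsometry_single g i⟩
  · have image_eq : w '' signedBasis n = signedBasis n := hw
    rw [← image_eq]
    exact Set.mem_image_of_mem w ⟨i, Or.inl rfl⟩

/-- The isomorphism from the group of signed permutations to the symmetry group of the cube. -/
def equivHyperoctahedral (n : ℕ) : SignedPerm (Fin n) ≃* hyperoctahedral n :=
  (MonoidHom.ofInjective toIsometry_injective).trans (MulEquiv.subgroupCongr range_toIsometry)

theorem equivHyperoctahedral_eq_iff {g : SignedPerm (Fin n)} {w : hyperoctahedral n} :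
    equivHyperoctahedral n g = w ↔ ∀ i, ((g.left (g.right i) : ℤ) : ℝ) •
      EuclideanSpace.single (g.right i) 1 = w.1 (EuclideanSpace.single i 1) := by
  simp only [← toIsometry_single]
  exact ⟨fun h i => h ▸ rfl, fun h => Subtype.ext (linearIsometryEquiv_ext_single h)⟩

theorem equivHyperoctahedral_flip (i : Fin n) :
    equivHyperoctahedral n (flip i) = invertReflection i := by
  refine equivHyperoctahedral_eq_iff.2 fun k => ?_
  change (((Pi.mulSingle (M := fun _ => ℤˣ) i (-1) k : ℤˣ) : ℤ) : ℝ) •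
    EuclideanSpace.single k 1 = rootReflection _ _
  by_cases hk : k = i
  · rw [hk, Pi.mulSingle_eq_same, rootReflection,
      Submodule.reflection_orthogonalComplement_singleton_eq_neg]
    simp
  · rw [Pi.mulSingle_eq_of_ne hk, Units.val_one, Int.cast_one, one_smul]
    refine (Submodule.reflection_mem_subspace_eq_self ?_).symm
    rw [Submodule.mem_orthogonal_singleton_iff_inner_right]
    simp [EuclideanSpace.inner_single_left, Ne.symm hk]

theorem equivHyperoctahedral_swap (i j : Fin n) :
    equivHyperoctahedral n (inr (swap i j)) = permuteReflection i j := by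
  refine equivHyperoctahedral_eq_iff.2 fun k => ?_
  change ((1 : ℤ) : ℝ) • EuclideanSpace.single (swap i j k) 1 = rootReflection _ _
  rw [Int.cast_one, one_smul]
  by_cases hi : k = i
  · rw [hi, swap_apply_left, rootReflection_sub_single]
  by_cases hj : k = j
  · rw [hj, swap_apply_right]
    have reflect_eq := congrArg (rootReflection (EuclideanSpace.single i 1 -
      EuclideanSpace.single j 1)) (rootReflection_sub_single i j)
    rwa [rootReflection_rootReflection] at reflect_eq
  · rw [swap_apply_of_ne_of_ne hi hj]
    refine (Submodule.reflection_mem_subspace_eq_self ?_).symm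
    rw [Submodule.mem_orthogonal_singleton_iff_inner_right]
    simp [inner_sub_left, EuclideanSpace.inner_single_left, Ne.symm hi, Ne.symm hj]

end Hyperoctahedral

end SignedPerm

end SignedPermutations

end

theorem mainTheorem8 :
    (∀ r : (n : ℕ) → hyperoctahedral n,
      (∀ (n : ℕ) (hn : 2 ≤ n), IsConj (r n)
        (permuteReflection (⟨0, by omega⟩ : Fin n) (⟨1, by omega⟩ : Fin n))) →
      Tendsto (fun n : ℕ => probMemKer (hyperoctahedral n) (r n)) atTop (𝓝 0)) ∧
    (∀ r : (n : ℕ) → hyperoctahedral n,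
      (∀ (n : ℕ) (hn : 1 ≤ n), IsConj (r n) (invertReflection (⟨0, by omega⟩ : Fin n))) →
      Tendsto (fun n : ℕ => probMemKer (hyperoctahedral n) (r n)) atTop (𝓝 (1 / 4))) := by
  have bound_tendsto := SignedPerm.tendsto_card_monoidHom_div_factorial (ℤˣ × ℤˣ)
  refine ⟨fun r hr => ?_, fun r hr => ?_⟩
  · refine squeeze_zero' (Eventually.of_forall fun n => probMemKer_nonneg _) ?_ bound_tendsto
    filter_upwards [eventually_ge_atTop 5] with n hn
    have card_ge : 5 ≤ Nat.card (Fin n) := by rwa [Nat.card_fin]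
    have swap_ne_one : Equiv.swap (⟨0, by omega⟩ : Fin n) ⟨1, by omega⟩ ≠ 1 := by
      simp [Equiv.swap_eq_one_iff]
    have bound := SignedPerm.probMemKer_inr_le card_ge swap_ne_one
    rwa [Nat.card_fin, ← probMemKer_mulEquiv (SignedPerm.equivHyperoctahedral n),
      SignedPerm.equivHyperoctahedral_swap, ← probMemKer_eq_of_isConj (hr n (by omega))] at bound
  · rw [tendsto_iff_dist_tendsto_zero]
    refine squeeze_zero' (Eventually.of_forall fun n => dist_nonneg) ?_ bound_tendsto
    filter_upwards [eventually_ge_atTop 7] with n hn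
    have card_ge : 7 ≤ Nat.card (Fin n) := by rwa [Nat.card_fin]
    have bound := SignedPerm.abs_probMemKer_flip_sub_le card_ge ⟨0, by omega⟩
    rwa [Nat.card_fin, ← probMemKer_mulEquiv (SignedPerm.equivHyperoctahedral n),
      SignedPerm.equivHyperoctahedral_flip, ← probMemKer_eq_of_isConj (hr n (by omega)),
      ← Real.dist_eq] at bound
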